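/- **Setting.** Let $\Lambda$ be a $d$-dimensional bipartite lattice: up to a linear automorphism of $\mathbb{R}^d$, its white vertices are $W=\mathbb{Z}^d$, its black vertices are $B=\mathbb{Z}^d+v_0$ with $v_0\notin\mathbb{Z}^d$, and each white vertex $w$ is joined exactly to the black vertices $w+e_1,\dots,w+e_D$, where $e_1,\dots,e_D$ are distinct vectors with $\sum_{i} e_i=0$, and the graph is connected. Let $\mathcal N(\Lambda)=\mathrm{conv}\{e_1,\dots,e_D\}$ be its Newton polytope, $F(\alpha)=\log\sum_{j=1}^D e^{e_j\cdot\alpha}$ the large-$N$ multinomial free energy, and $\sigma(s)=\sup_{\alpha\in\mathbb{R}^d}\big(s\cdot\alpha-F(\alpha)\big)$, $s\in\mathcal N(\Lambda)$, the surface tension. Let $R\subset\mathbb{R}^d$ be a compact connected set that is the closure of its interior $R^\circ$ (no regularity of $\partial R$ is needed), and let $b$ be a finite signed Borel measure on $\mathbb{R}^d$. Let $\mathrm{AF}(\Lambda,R,b)$ be the set of measurable vector fields $\omega$ on $\mathbb{R}^d$ (up to a.e. equality) that vanish outside $R$, take values in $\mathcal N(\Lambda)$, are divergence-free as distributions in $R^\circ$,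 and have outward flux $b$ through $\partial R$ in the sense that $$\int \varphi\,db=\int_R \nabla\varphi\cdot\omega\,dx\qquad\text{for all }\varphi\in C_c^\infty(\mathbb{R}^d)$$ (for smooth $\omega$ and piecewise smooth $\partial R$ this means $b=\langle\omega,\xi\rangle\,dS$ on $\partial R$, with $\xi$ the outward unit normal and $dS$ the surface measure). The pair $(R,b)$ is *flexible* if every $x\in R^\circ$ has a neighbourhood $U\subset R$ for which there is some $\omega\in\mathrm{AF}(\Lambda,R,b)$ with $\omega\in\mathcal N(\Lambda)^\circ$ a.e. on $U$. The *limit shape* of the $N\to\infty$ multinomial dimer model for $(R,b)$ is the minimizer of $\int_R\sigma(\omega(x))\,dx$ over $\omega\in\mathrm{AF}(\Lambda,R,b)$. A *facet* of $\omega$ is a set $A\subset R^\circ$ of positive Lebesgue measure with $\omega\in\partial\mathcal N(\Lambda)$ a.e. on $A$. **Theorem (no facets).** For every such $\Lambda$, $R$, $b$ with $(R,b)$ flexible, the limit shape $\omega$ (that is, any minimizer as above) satisfies $\omega(x)\in\mathcal N(\Lambda)^\circ$ for almost every $x\in R^\circ$. In particular $\omega$ has no facets. -/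

import Mathlib

open MeasureTheory Set Filter Topology
open scoped InnerProductSpace

noncomputable section

/-- The graph with white vertex set `W` in which each white vertex `w` is joined to `w + e`
for every `e` in the finite set `edges` of edge vectors. -/
def translationGraph {d : ℕ} (W : Set (EuclideanSpace ℝ (Fin d)))
    (edges : Finset (EuclideanSpace ℝ (Fin d))) : SimpleGraph (EuclideanSpace ℝ (Fin d)) :=
  SimpleGraph.fromRel fun x y => x ∈ W ∧ y - x ∈ edges

/-- A `d`-dimensional bipartite lattice: a linear image of a graph with white vertices `ℤ^d` and
black vertices `ℤ^d + v₀`, invariant under translations by `ℤ^d`, each white vertex `w` being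
joined to `w + e_1, …, w + e_D`, connected, and harmonically embedded (`e_1 + ⋯ + e_D = 0`). -/
structure DimerLattice (d : ℕ) where
  /-- The white vertices are the integer combinations of this basis of `ℝ^d`. -/
  basis : Module.Basis (Fin d) ℝ (EuclideanSpace ℝ (Fin d))
  /-- The black vertices are the white vertices translated by this vector. -/
  offset : EuclideanSpace ℝ (Fin d)
  /-- The edge vectors `e_1, …, e_D`, oriented from white to black. -/
  edges : Finset (EuclideanSpace ℝ (Fin d))
  /-- White and black vertices are distinct. -/
  offset_notMem : offset ∉ Submodule.span ℤ (range basis)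
  /-- Edges join white vertices to black vertices. -/
  edges_mem : ∀ e ∈ edges, e - offset ∈ Submodule.span ℤ (range basis)
  connected : ((translationGraph (Submodule.span ℤ (range basis) : Set _) edges).induce
    {x | x ∈ Submodule.span ℤ (range basis) ∨
      x - offset ∈ Submodule.span ℤ (range basis)}).Connected
  harmonic : ∑ e ∈ edges, e = 0

namespace DimerLattice

variable {d : ℕ} (Λ : DimerLattice d)

/-- The Newton polytope: the convex hull of the edge vectors. -/
def newtonPolytope : Set (EuclideanSpace ℝ (Fin d)) :=
  convexHull ℝ (Λ.edges : Set (EuclideanSpace ℝ (Fin d)))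

/-- The large-`N` multinomial free energy `F(α) = log ∑_j exp (e_j · α)`. -/
def freeEnergy (α : EuclideanSpace ℝ (Fin d)) : ℝ :=
  Real.log (∑ e ∈ Λ.edges, Real.exp ⟪e, α⟫_ℝ)

/-- The surface tension: the Legendre dual `σ(s) = sup_α (s · α - F(α))` of the free energy.
It is only used for `s` in the Newton polytope, where the supremum is finite. -/
def surfaceTension (s : EuclideanSpace ℝ (Fin d)) : ℝ :=
  ⨆ α : EuclideanSpace ℝ (Fin d), (⟪s, α⟫_ℝ - Λ.freeEnergy α)

/-- On the Newton polytope the supremum defining the surface tension is over a set that is bounded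
above (by `0`), so it is a genuine supremum. -/
theorem bddAbove_range_legendre {s : EuclideanSpace ℝ (Fin d)} (hs : s ∈ Λ.newtonPolytope) :
    BddAbove (range fun α : EuclideanSpace ℝ (Fin d) => ⟪s, α⟫_ℝ - Λ.freeEnergy α) := by
  refine ⟨0, ?_⟩
  rintro _ ⟨α, rfl⟩
  have hsub : Λ.newtonPolytope ⊆ {x | ⟪α, x⟫_ℝ ≤ Λ.freeEnergy α} := by
    refine convexHull_min ?_ (convex_halfSpace_le (innerₛₗ ℝ α).isLinear _)
    intro e he
    have he' : e ∈ Λ.edges := he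
    have h1 : Real.exp ⟪e, α⟫_ℝ ≤ ∑ e ∈ Λ.edges, Real.exp ⟪e, α⟫_ℝ :=
      Finset.single_le_sum (f := fun e => Real.exp ⟪e, α⟫_ℝ)
        (fun i _ => (Real.exp_pos _).le) he'
    have h2 := Real.log_le_log (Real.exp_pos _) h1
    rw [Real.log_exp] at h2
    show ⟪α, e⟫_ℝ ≤ _
    rw [real_inner_comm]
    exact h2
  have h := hsub hs
  have h' : ⟪s, α⟫_ℝ ≤ Λ.freeEnergy α := by
    rw [real_inner_comm]; exact h
  simpa using h'

end DimerLattice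

/-- A compact connected domain in `ℝ^d`, where a domain is the closure of its interior. -/
structure IsCompactDomain {d : ℕ} (R : Set (EuclideanSpace ℝ (Fin d))) : Prop where
  isCompact : IsCompact R
  isConnected : IsConnected R
  closure_interior : closure (interior R) = R

/-- `ω` is an asymptotic flow on `R` for `Λ`: a measurable vector field which is supported in `R`,
divergence-free as a distribution in the interior of `R`, and valued in the Newton polytope.
As usual, measurable vector fields are considered up to almost everywhere equality. -/
structure IsAsymptoticFlow {d : ℕ} (Λ : DimerLattice d) (R : Set (EuclideanSpace ℝ (Fin d)))
    (ω : EuclideanSpace ℝ (Fin d) → EuclideanSpace ℝ (Fin d)) : Prop where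
  aemeasurable : AEMeasurable ω volume
  support : ∀ᵐ x, x ∉ R → ω x = 0
  div_free : ∀ φ : EuclideanSpace ℝ (Fin d) → ℝ, ContDiff ℝ (⊤ : ℕ∞) φ → HasCompactSupport φ →
    tsupport φ ⊆ interior R → ∫ x in R, fderiv ℝ φ x (ω x) = 0
  mem_newtonPolytope : ∀ᵐ x, x ∈ R → ω x ∈ Λ.newtonPolytope

/-- The integral of a function against a signed measure. -/
def signedIntegral {d : ℕ} (b : SignedMeasure (EuclideanSpace ℝ (Fin d)))
    (φ : EuclideanSpace ℝ (Fin d) → ℝ) : ℝ :=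
  (∫ x, φ x ∂b.toJordanDecomposition.posPart) - ∫ x, φ x ∂b.toJordanDecomposition.negPart

/-- The boundary value (outward flux through `∂R`) of `ω` is the signed measure `b`, in the weak
sense of the Gauss-Green formula `∫_∂R φ db = ∫_R ∇φ · ω dx`. For a divergence-free `ω` that is
smooth up to a piecewise smooth boundary this says `b = ⟨ω, ξ⟩ dS` with `ξ` the outward unit
normal and `dS` the surface measure of `∂R`; the condition is stable under weak limits of flows,
and it determines `b`, which for an asymptotic flow is automatically carried by `∂R`. -/
def HasBoundaryValue {d : ℕ} (R : Set (EuclideanSpace ℝ (Fin d)))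
    (ω : EuclideanSpace ℝ (Fin d) → EuclideanSpace ℝ (Fin d))
    (b : SignedMeasure (EuclideanSpace ℝ (Fin d))) : Prop :=
  ∀ φ : EuclideanSpace ℝ (Fin d) → ℝ, ContDiff ℝ (⊤ : ℕ∞) φ → HasCompactSupport φ →
    signedIntegral b φ = ∫ x in R, fderiv ℝ φ x (ω x)

/-- `AF(Λ, R, b)`: the asymptotic flows on `R` for `Λ` with boundary value `b`. -/
def asymptoticFlows {d : ℕ} (Λ : DimerLattice d) (R : Set (EuclideanSpace ℝ (Fin d)))
    (b : SignedMeasure (EuclideanSpace ℝ (Fin d))) :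
    Set (EuclideanSpace ℝ (Fin d) → EuclideanSpace ℝ (Fin d)) :=
  {ω | IsAsymptoticFlow Λ R ω ∧ HasBoundaryValue R ω b}

/-- `(R, b)` is flexible for `Λ`: every interior point of `R` has a neighbourhood `U` in `R` and
an asymptotic flow with boundary value `b` which is valued in the interior of the Newton polytope
almost everywhere on `U`. -/
def IsFlexible {d : ℕ} (Λ : DimerLattice d) (R : Set (EuclideanSpace ℝ (Fin d)))
    (b : SignedMeasure (EuclideanSpace ℝ (Fin d))) : Prop :=
  ∀ x ∈ interior R, ∃ U ∈ 𝓝 x, U ⊆ R ∧ ∃ ω ∈ asymptoticFlows Λ R b,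
    ∀ᵐ y, y ∈ U → ω y ∈ interior Λ.newtonPolytope

/-- `ω` is the limit shape of the large-`N` multinomial dimer model for `Λ` and `(R, b)`: it
minimizes `∫_R σ(ω(x)) dx` (the large deviation rate function, up to an additive constant) over
the asymptotic flows on `R` with boundary value `b`. -/
def IsLimitShape {d : ℕ} (Λ : DimerLattice d) (R : Set (EuclideanSpace ℝ (Fin d)))
    (b : SignedMeasure (EuclideanSpace ℝ (Fin d)))
    (ω : EuclideanSpace ℝ (Fin d) → EuclideanSpace ℝ (Fin d)) : Prop :=
  IsMinOn (fun ω' => ∫ x in R, Λ.surfaceTension (ω' x)) (asymptoticFlows Λ R b) ω ∧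
    ω ∈ asymptoticFlows Λ R b

/-- `A` is a facet of `ω`: a subset of the interior of `R`, of positive measure, on which `ω` takes
values in the boundary of the Newton polytope. -/
def IsFacet {d : ℕ} (Λ : DimerLattice d) (R : Set (EuclideanSpace ℝ (Fin d)))
    (ω : EuclideanSpace ℝ (Fin d) → EuclideanSpace ℝ (Fin d))
    (A : Set (EuclideanSpace ℝ (Fin d))) : Prop :=
  A ⊆ interior R ∧ 0 < volume A ∧ ∀ᵐ x, x ∈ A → ω x ∈ frontier Λ.newtonPolytope

end

namespace DimerLattice

variable {d : ℕ} (Λ : DimerLattice d)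

/-! The surface tension σ is convex and bounded on the Newton polytope, but from a boundary point s
towards an interior point s₀ its one-sided slope is -∞, as for t log t at 0. Moving a limit shape ω
by a fraction t towards a flow ω' therefore gains more than any multiple of t where ω is on the
boundary and ω' is interior, and by convexity loses at most O(t) elsewhere. Minimality makes that
set null (`IsLimitShape.ae_mem_interior`). Flexibility supplies such an ω' near every interior point
of R.

The slope (`eventually_surfaceTension_le_sub`) comes from a bound uniform in the dual variable α.
Let q be the Gibbs weight at α of an edge e₀ off a supporting hyperplane at s. The Legendre
functional of s falls short of σ(s) by at least q/2, and that of s₀ is at most c log q with c > 0.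
At (1-t)s + ts₀, a q large compared with t pays through the first bound, a small q through the
second. -/

theorem edges_nonempty {s : EuclideanSpace ℝ (Fin d)} (hs : s ∈ Λ.newtonPolytope) :
    Λ.edges.Nonempty := by
  have h : (convexHull ℝ (Λ.edges : Set (EuclideanSpace ℝ (Fin d)))).Nonempty := ⟨s, hs⟩
  rw [convexHull_nonempty_iff] at h
  exact_mod_cast h

theorem convex_newtonPolytope : Convex ℝ Λ.newtonPolytope :=
  convex_convexHull ℝ _

theorem isCompact_newtonPolytope : IsCompact Λ.newtonPolytope :=
  Λ.edges.finite_toSet.isCompact_convexHull ℝ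

theorem le_surfaceTension {s : EuclideanSpace ℝ (Fin d)} (hs : s ∈ Λ.newtonPolytope)
    (α : EuclideanSpace ℝ (Fin d)) : ⟪s, α⟫_ℝ - Λ.freeEnergy α ≤ Λ.surfaceTension s :=
  le_ciSup (Λ.bddAbove_range_legendre hs) α

theorem inner_le_freeEnergy {s : EuclideanSpace ℝ (Fin d)} (hs : s ∈ Λ.newtonPolytope)
    (α : EuclideanSpace ℝ (Fin d)) : ⟪s, α⟫_ℝ ≤ Λ.freeEnergy α := by
  have hsub : Λ.newtonPolytope ⊆ {x | ⟪α, x⟫_ℝ ≤ Λ.freeEnergy α} := by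
    refine convexHull_min ?_ (convex_halfSpace_le (innerₛₗ ℝ α).isLinear _)
    intro e he
    have h2 := Real.log_le_log (Real.exp_pos _)
      (Finset.single_le_sum (f := fun e => Real.exp ⟪e, α⟫_ℝ)
        (fun i _ => (Real.exp_pos _).le) (Finset.mem_coe.1 he))
    rw [Real.log_exp] at h2
    show ⟪α, e⟫_ℝ ≤ _
    rw [real_inner_comm]
    exact h2
  rw [real_inner_comm]
  exact hsub hs

theorem surfaceTension_nonpos {s : EuclideanSpace ℝ (Fin d)} (hs : s ∈ Λ.newtonPolytope) :
    Λ.surfaceTension s ≤ 0 :=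
  ciSup_le fun α => sub_nonpos.2 (Λ.inner_le_freeEnergy hs α)

theorem neg_log_card_le_surfaceTension {s : EuclideanSpace ℝ (Fin d)}
    (hs : s ∈ Λ.newtonPolytope) : -Real.log Λ.edges.card ≤ Λ.surfaceTension s := by
  simpa [freeEnergy] using Λ.le_surfaceTension hs 0

/-- For fixed α the Legendre functional is affine in s, and a supremum of affine functions is
convex. -/
theorem surfaceTension_convexCombination_le {s s' : EuclideanSpace ℝ (Fin d)}
    (hs : s ∈ Λ.newtonPolytope) (hs' : s' ∈ Λ.newtonPolytope) {t : ℝ} (ht0 : 0 ≤ t)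
    (ht1 : t ≤ 1) :
    Λ.surfaceTension ((1 - t) • s + t • s') ≤
      (1 - t) * Λ.surfaceTension s + t * Λ.surfaceTension s' := by
  refine ciSup_le fun α => ?_
  have h1 := mul_le_mul_of_nonneg_left (Λ.le_surfaceTension hs α) (sub_nonneg.2 ht1)
  have h2 := mul_le_mul_of_nonneg_left (Λ.le_surfaceTension hs' α) ht0
  rw [inner_add_left, real_inner_smul_left, real_inner_smul_left]
  linarith

/-! ### Infinite slope of the surface tension at the boundary -/

/-- A non-interior point of the Newton polytope has a supporting hyperplane that misses some
edge vector. -/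
theorem exists_supporting_vector {s s₀ : EuclideanSpace ℝ (Fin d)}
    (hs : s ∉ interior Λ.newtonPolytope) (hs₀ : s₀ ∈ interior Λ.newtonPolytope) :
    ∃ u : EuclideanSpace ℝ (Fin d), (∀ e ∈ Λ.edges, ⟪e, u⟫_ℝ ≤ ⟪s, u⟫_ℝ) ∧
      ∃ e₀ ∈ Λ.edges, ⟪e₀, u⟫_ℝ < ⟪s, u⟫_ℝ := by
  obtain ⟨f, hf⟩ := geometric_hahn_banach_open_point Λ.convex_newtonPolytope.interior
    isOpen_interior hs
  set u := (InnerProductSpace.toDual ℝ (EuclideanSpace ℝ (Fin d))).symm f with hu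
  have hfu : ∀ x, ⟪x, u⟫_ℝ = f x := fun x => by
    rw [real_inner_comm, hu, InnerProductSpace.toDual_symm_apply]
  -- The separation only controls the interior. Since the interior is nonempty, its closure contains
  -- the edge vectors, where the inequality becomes weak.
  have hcl : Λ.newtonPolytope ⊆ closure (interior Λ.newtonPolytope) := by
    rw [Λ.convex_newtonPolytope.closure_interior_eq_closure_of_nonempty_interior ⟨s₀, hs₀⟩]
    exact subset_closure
  refine ⟨u, fun e he => ?_, ?_⟩
  · have : closure (interior Λ.newtonPolytope) ⊆ {x | f x ≤ f s} :=
      closure_minimal (fun x hx => (hf x hx).le) (isClosed_le f.continuous continuous_const)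
    rw [hfu, hfu]
    exact this (hcl (subset_convexHull ℝ _ he))
  · by_contra! hcon
    simp only [hfu] at hcon
    have : Λ.newtonPolytope ⊆ {x | f s ≤ f x} :=
      convexHull_min (fun e he => hcon e he) (convex_halfSpace_ge f.toLinearMap.isLinear _)
    exact absurd (hf s₀ hs₀) (not_lt.2 (this (interior_subset hs₀)))

/-- Tilting the dual variable away from an edge `e₀` that misses a supporting hyperplane at `s`
improves the Legendre functional by half of the Gibbs weight of `e₀`. -/
theorem legendre_add_gibbsWeight_le {s u e₀ : EuclideanSpace ℝ (Fin d)}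
    (hs : s ∈ Λ.newtonPolytope) (hu : ∀ e ∈ Λ.edges, ⟪e, u⟫_ℝ ≤ ⟪s, u⟫_ℝ)
    (he₀ : e₀ ∈ Λ.edges) (hlt : ⟪e₀, u⟫_ℝ < ⟪s, u⟫_ℝ) (α : EuclideanSpace ℝ (Fin d)) :
    ⟪s, α⟫_ℝ - Λ.freeEnergy α + Real.exp (⟪e₀, α⟫_ℝ - Λ.freeEnergy α) / 2 ≤
      Λ.surfaceTension s := by
  -- Replacing α by α + l u multiplies each edge weight by at most exp(l s·u), and that of e₀ by
  -- exactly half of this.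
  set l : ℝ := Real.log 2 / (⟪s, u⟫_ℝ - ⟪e₀, u⟫_ℝ) with hl
  have hδ : 0 < ⟪s, u⟫_ℝ - ⟪e₀, u⟫_ℝ := sub_pos.2 hlt
  have hl0 : 0 ≤ l := div_nonneg (Real.log_nonneg (by norm_num)) hδ.le
  have hlδ : l * (⟪s, u⟫_ℝ - ⟪e₀, u⟫_ℝ) = Real.log 2 := div_mul_cancel₀ _ hδ.ne'
  set S : ℝ := ∑ e ∈ Λ.edges, Real.exp ⟪e, α⟫_ℝ with hS
  have hSpos : 0 < S := Finset.sum_pos (fun e _ => Real.exp_pos _) ⟨e₀, he₀⟩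
  have hexpF : Real.exp (Λ.freeEnergy α) = S := Real.exp_log hSpos
  set q : ℝ := Real.exp (⟪e₀, α⟫_ℝ - Λ.freeEnergy α) with hq
  have hqS : Real.exp ⟪e₀, α⟫_ℝ = q * S := by
    rw [hq, ← hexpF, ← Real.exp_add]; congr 1; ring
  have hsum : ∑ e ∈ Λ.edges, Real.exp ⟪e, α + l • u⟫_ℝ ≤
      Real.exp (l * ⟪s, u⟫_ℝ) * (S * (1 - q / 2)) := by
    have hterm : ∀ e ∈ Λ.edges, Real.exp ⟪e, α + l • u⟫_ℝ ≤
        Real.exp (l * ⟪s, u⟫_ℝ) *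
          (Real.exp ⟪e, α⟫_ℝ - if e = e₀ then Real.exp ⟪e₀, α⟫_ℝ / 2 else 0) := by
      intro e he
      rw [inner_add_right, real_inner_smul_right]
      split_ifs with h
      · subst h
        have : ⟪e, α⟫_ℝ + l * ⟪e, u⟫_ℝ = l * ⟪s, u⟫_ℝ + ⟪e, α⟫_ℝ + -Real.log 2 := by
          rw [← hlδ]; ring
        rw [this, Real.exp_add, Real.exp_add, Real.exp_neg, Real.exp_log (by norm_num)]
        apply le_of_eq; ring
      · rw [sub_zero, ← Real.exp_add, Real.exp_le_exp]
        linarith [mul_le_mul_of_nonneg_left (hu e he) hl0]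
    refine (Finset.sum_le_sum hterm).trans_eq ?_
    rw [← Finset.mul_sum, Finset.sum_sub_distrib, Finset.sum_ite_eq' Λ.edges e₀,
      if_pos he₀, hqS]
    ring
  have hpos : 0 < ∑ e ∈ Λ.edges, Real.exp ⟪e, α + l • u⟫_ℝ :=
    Finset.sum_pos (fun e _ => Real.exp_pos _) ⟨e₀, he₀⟩
  have hfac : 0 < 1 - q / 2 := by
    have h := hpos.trans_le hsum
    exact pos_of_mul_pos_right (pos_of_mul_pos_right h (Real.exp_pos _).le) hSpos.le
  have hF : Λ.freeEnergy (α + l • u) ≤ l * ⟪s, u⟫_ℝ + Λ.freeEnergy α - q / 2 := by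
    have h := Real.log_le_log hpos hsum
    rw [Real.log_mul (Real.exp_pos _).ne' (mul_pos hSpos hfac).ne', Real.log_exp,
      Real.log_mul hSpos.ne' hfac.ne'] at h
    have h' := Real.log_le_sub_one_of_pos hfac
    show Real.log _ ≤ l * ⟪s, u⟫_ℝ + Real.log S - q / 2
    linarith
  have h := Λ.le_surfaceTension hs (α + l • u)
  rw [inner_add_right, real_inner_smul_right] at h
  linarith

/-- An interior point of the Newton polytope gives positive weight to every edge. -/
theorem exists_weight {s₀ e₀ : EuclideanSpace ℝ (Fin d)}
    (hs₀ : s₀ ∈ interior Λ.newtonPolytope) :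
    ∃ c : ℝ, 0 < c ∧ c ≤ 1 ∧ ∃ z ∈ Λ.newtonPolytope, s₀ = c • e₀ + (1 - c) • z := by
  -- The witness z lies slightly beyond s₀ on the ray from e₀.
  have hcont : Continuous fun η : ℝ => s₀ + η • (s₀ - e₀) := by fun_prop
  have hev : ∀ᶠ η : ℝ in 𝓝 0, s₀ + η • (s₀ - e₀) ∈ Λ.newtonPolytope := by
    have := hcont.tendsto 0
    simp only [zero_smul, add_zero] at this
    exact this (mem_interior_iff_mem_nhds.1 hs₀)
  obtain ⟨η, hη, hη0⟩ :=
    ((hev.filter_mono nhdsWithin_le_nhds).and (self_mem_nhdsWithin (s := Ioi (0 : ℝ)))).exists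
  have hη0 : 0 < η := hη0
  refine ⟨η / (1 + η), by positivity, (div_le_one (by positivity)).2 (by linarith), _, hη, ?_⟩
  have h1 : 1 - η / (1 + η) = 1 / (1 + η) := by field_simp; ring
  have h2 : (1 + η) ≠ 0 := by positivity
  rw [h1]
  ext i
  simp only [PiLp.add_apply, PiLp.smul_apply, PiLp.sub_apply, smul_eq_mul]
  field_simp
  ring

/-- The surface tension has slope `-∞` at the boundary of the Newton polytope in every direction
that points into the interior. -/
theorem eventually_surfaceTension_le_sub {s s₀ : EuclideanSpace ℝ (Fin d)}
    (hs : s ∈ Λ.newtonPolytope) (hs' : s ∉ interior Λ.newtonPolytope)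
    (hs₀ : s₀ ∈ interior Λ.newtonPolytope) (K : ℝ) :
    ∀ᶠ t : ℝ in 𝓝[>] 0,
      Λ.surfaceTension ((1 - t) • s + t • s₀) ≤ Λ.surfaceTension s - K * t := by
  obtain ⟨u, hu, e₀, he₀, hlt⟩ := Λ.exists_supporting_vector hs' hs₀
  obtain ⟨c, hc0, hc1, z, hz, hs₀z⟩ := Λ.exists_weight (e₀ := e₀) hs₀
  set C := Real.log Λ.edges.card
  have hσ := Λ.neg_log_card_le_surfaceTension hs
  -- If q ≥ Lt, then the loss q/4 is at least (K + C)t. The maximum with 1 only keeps L positive.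
  set L : ℝ := max 1 (4 * (K + C))
  have hL : 0 < L := lt_of_lt_of_le one_pos (le_max_left _ _)
  have hlog : ∀ᶠ t : ℝ in 𝓝[>] 0, Real.log (L * t) ≤ -(K + C) / c := by
    have : Tendsto (fun t : ℝ => Real.log (L * t)) (𝓝[>] 0) atBot := by
      refine Real.tendsto_log_nhdsGT_zero.comp (tendsto_nhdsWithin_iff.2 ⟨?_, ?_⟩)
      · have : Tendsto (fun t : ℝ => L * t) (𝓝 0) (𝓝 (L * 0)) :=
          (continuous_const.mul continuous_id).tendsto 0
        rw [mul_zero] at this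
        exact this.mono_left nhdsWithin_le_nhds
      · filter_upwards [self_mem_nhdsWithin] with t ht
        exact mul_pos hL ht
    exact this.eventually_le_atBot _
  have hhalf : ∀ᶠ t : ℝ in 𝓝[>] 0, t < 1 / 2 :=
    nhdsWithin_le_nhds (Iio_mem_nhds (by norm_num))
  filter_upwards [hlog, hhalf, self_mem_nhdsWithin] with t hlogt ht2 ht0
  have ht0 : 0 < t := ht0
  refine ciSup_le fun α => ?_
  set q : ℝ := Real.exp (⟪e₀, α⟫_ℝ - Λ.freeEnergy α) with hq
  have hq0 : 0 < q := Real.exp_pos _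
  have hlogq : Real.log q = ⟪e₀, α⟫_ℝ - Λ.freeEnergy α := Real.log_exp _
  have hlogq0 : Real.log q ≤ 0 := by
    rw [hlogq]
    linarith [Λ.inner_le_freeEnergy (subset_convexHull ℝ _ he₀) α]
  have hx := Λ.legendre_add_gibbsWeight_le hs hu he₀ hlt α
  have hy : ⟪s₀, α⟫_ℝ - Λ.freeEnergy α ≤ c * Real.log q := by
    rw [hlogq, hs₀z, inner_add_left, real_inner_smul_left, real_inner_smul_left]
    linarith [mul_le_mul_of_nonneg_left (Λ.inner_le_freeEnergy hz α) (sub_nonneg.2 hc1)]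
  -- The term tC pays for replacing (1-t)σ(s) by σ(s), as σ(s) ≥ -C. Since t < 1/2, at least q/4 of
  -- (1-t)q/2 remains.
  have hV : ⟪(1 - t) • s + t • s₀, α⟫_ℝ - Λ.freeEnergy α ≤
      Λ.surfaceTension s + t * C - q / 4 + t * (c * Real.log q) := by
    rw [inner_add_left, real_inner_smul_left, real_inner_smul_left]
    have h1 : (1 - t) * (⟪s, α⟫_ℝ - Λ.freeEnergy α) ≤
        (1 - t) * (Λ.surfaceTension s - q / 2) :=
      mul_le_mul_of_nonneg_left (by linarith) (by linarith)
    have h2 := mul_le_mul_of_nonneg_left hy ht0.le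
    have h3 := mul_le_mul_of_nonneg_left hσ ht0.le
    have h4 : t * q ≤ 1 / 2 * q := mul_le_mul_of_nonneg_right ht2.le hq0.le
    linarith
  refine hV.trans ?_
  rcases le_total (L * t) q with h | h
  · have h1 : 4 * (K + C) * t ≤ L * t := mul_le_mul_of_nonneg_right (le_max_right _ _) ht0.le
    have h2 : t * (c * Real.log q) ≤ 0 :=
      mul_nonpos_of_nonneg_of_nonpos ht0.le (mul_nonpos_of_nonneg_of_nonpos hc0.le hlogq0)
    linarith
  · have h1 : c * Real.log q ≤ -(K + C) := by
      have := (Real.log_le_log hq0 h).trans hlogt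
      rw [le_div_iff₀ hc0] at this
      linarith
    have h2 := mul_le_mul_of_nonneg_left h1 ht0.le
    linarith

/-! ### Measurability and integrability of the energy density -/

theorem continuous_freeEnergy (hΛ : Λ.edges.Nonempty) : Continuous Λ.freeEnergy := by
  refine Continuous.log (by fun_prop) fun α => ?_
  exact (Finset.sum_pos (fun e _ => Real.exp_pos _) hΛ).ne'

/-- A countable supremum gives measurability of σ ∘ ω without proving continuity of σ up to the
boundary. -/
theorem surfaceTension_eq_iSup_denseSeq {s : EuclideanSpace ℝ (Fin d)}
    (hs : s ∈ Λ.newtonPolytope) :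
    Λ.surfaceTension s = ⨆ n : ℕ, (⟪s, TopologicalSpace.denseSeq _ n⟫_ℝ -
      Λ.freeEnergy (TopologicalSpace.denseSeq (EuclideanSpace ℝ (Fin d)) n)) := by
  have hcont : Continuous fun α => ⟪s, α⟫_ℝ - Λ.freeEnergy α :=
    (by fun_prop : Continuous fun α => ⟪s, α⟫_ℝ).sub
      (Λ.continuous_freeEnergy (Λ.edges_nonempty hs))
  have h := (TopologicalSpace.denseRange_denseSeq (EuclideanSpace ℝ (Fin d))).ciSup' hcont
  rw [← iSup_range' (fun α => ⟪s, α⟫_ℝ - Λ.freeEnergy α)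
    (TopologicalSpace.denseSeq (EuclideanSpace ℝ (Fin d)))]
  exact h.symm

theorem aemeasurable_surfaceTension_comp {X : Type*} [MeasurableSpace X] {μ : Measure X}
    {ω : X → EuclideanSpace ℝ (Fin d)} (hω : AEMeasurable ω μ)
    (hmem : ∀ᵐ x ∂μ, ω x ∈ Λ.newtonPolytope) :
    AEMeasurable (fun x => Λ.surfaceTension (ω x)) μ := by
  have h : AEMeasurable (fun x => ⨆ n : ℕ, (⟪ω x, TopologicalSpace.denseSeq _ n⟫_ℝ -
      Λ.freeEnergy (TopologicalSpace.denseSeq (EuclideanSpace ℝ (Fin d)) n))) μ :=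
    AEMeasurable.iSup fun n => (hω.inner_const).sub_const _
  refine h.congr ?_
  filter_upwards [hmem] with x hx
  exact (Λ.surfaceTension_eq_iSup_denseSeq hx).symm

theorem integrable_surfaceTension_comp {X : Type*} [MeasurableSpace X] {μ : Measure X}
    [IsFiniteMeasure μ] {ω : X → EuclideanSpace ℝ (Fin d)} (hω : AEMeasurable ω μ)
    (hmem : ∀ᵐ x ∂μ, ω x ∈ Λ.newtonPolytope) :
    Integrable (fun x => Λ.surfaceTension (ω x)) μ := by
  refine Integrable.of_bound (Λ.aemeasurable_surfaceTension_comp hω hmem).aestronglyMeasurable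
    (Real.log Λ.edges.card) ?_
  filter_upwards [hmem] with x hx
  have h1 := Λ.surfaceTension_nonpos hx
  have h2 := Λ.neg_log_card_le_surfaceTension hx
  rw [Real.norm_eq_abs, abs_of_nonpos h1]
  linarith

end DimerLattice

/-! ### Convexity of the set of flows and the variational argument -/

section Flows

variable {d : ℕ} {Λ : DimerLattice d} {R : Set (EuclideanSpace ℝ (Fin d))}
  {b : SignedMeasure (EuclideanSpace ℝ (Fin d))}
  {ω ω' : EuclideanSpace ℝ (Fin d) → EuclideanSpace ℝ (Fin d)}

theorem IsAsymptoticFlow.ae_restrict_mem (h : IsAsymptoticFlow Λ R ω) (hR : IsCompact R) :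
    ∀ᵐ x ∂volume.restrict R, ω x ∈ Λ.newtonPolytope :=
  (ae_restrict_iff' hR.measurableSet).2 h.mem_newtonPolytope

theorem IsAsymptoticFlow.integrableOn_fderiv (h : IsAsymptoticFlow Λ R ω) (hR : IsCompact R)
    {φ : EuclideanSpace ℝ (Fin d) → ℝ} (hφ : ContDiff ℝ (⊤ : ℕ∞) φ)
    (hφc : HasCompactSupport φ) : IntegrableOn (fun x => fderiv ℝ φ x (ω x)) R := by
  have hcont : Continuous (fderiv ℝ φ) := hφ.continuous_fderiv (by simp)
  obtain ⟨C, hC⟩ := hcont.bounded_above_of_compact_support (hφc.fderiv ℝ)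
  obtain ⟨M, hM⟩ := Λ.isCompact_newtonPolytope.isBounded.exists_norm_le
  have : IsFiniteMeasure (volume.restrict R) := ⟨by simpa using hR.measure_lt_top⟩
  refine Integrable.of_bound ?_ (C * M) ?_
  · exact ((ContinuousLinearMap.id ℝ (EuclideanSpace ℝ (Fin d) →L[ℝ] ℝ)).aestronglyMeasurable_comp₂
      hcont.aestronglyMeasurable h.aemeasurable.aestronglyMeasurable).restrict
  · filter_upwards [h.ae_restrict_mem hR] with x hx
    have hC0 : 0 ≤ C := (norm_nonneg _).trans (hC x)
    exact ((fderiv ℝ φ x).le_opNorm _).trans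
      (mul_le_mul (hC x) (hM _ hx) (norm_nonneg _) hC0)

theorem setIntegral_fderiv_convexCombination (hR : IsCompact R) (h : IsAsymptoticFlow Λ R ω)
    (h' : IsAsymptoticFlow Λ R ω') (t : ℝ) {φ : EuclideanSpace ℝ (Fin d) → ℝ}
    (hφ : ContDiff ℝ (⊤ : ℕ∞) φ) (hφc : HasCompactSupport φ) :
    ∫ x in R, fderiv ℝ φ x ((1 - t) • ω x + t • ω' x) =
      (1 - t) * (∫ x in R, fderiv ℝ φ x (ω x)) + t * ∫ x in R, fderiv ℝ φ x (ω' x) := by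
  simp only [map_add, map_smul, smul_eq_mul]
  rw [integral_add ((h.integrableOn_fderiv hR hφ hφc).const_mul _)
    ((h'.integrableOn_fderiv hR hφ hφc).const_mul _), integral_const_mul, integral_const_mul]

/-- The divergence and boundary conditions are affine in the flow, and the polytope is convex. -/
theorem convexCombination_mem_asymptoticFlows (hR : IsCompact R)
    (h : ω ∈ asymptoticFlows Λ R b) (h' : ω' ∈ asymptoticFlows Λ R b) {t : ℝ} (ht0 : 0 ≤ t)
    (ht1 : t ≤ 1) : (fun x => (1 - t) • ω x + t • ω' x) ∈ asymptoticFlows Λ R b := by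
  refine ⟨⟨?_, ?_, ?_, ?_⟩, ?_⟩
  · exact (h.1.aemeasurable.const_smul (1 - t)).add (h'.1.aemeasurable.const_smul t)
  · filter_upwards [h.1.support, h'.1.support] with x hx hx' hxR
    rw [hx hxR, hx' hxR, smul_zero, smul_zero, add_zero]
  · intro φ hφ hφc hsupp
    rw [setIntegral_fderiv_convexCombination hR h.1 h'.1 t hφ hφc, h.1.div_free φ hφ hφc hsupp,
      h'.1.div_free φ hφ hφc hsupp, mul_zero, mul_zero, add_zero]
  · filter_upwards [h.1.mem_newtonPolytope, h'.1.mem_newtonPolytope] with x hx hx' hxR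
    exact Λ.convex_newtonPolytope (hx hxR) (hx' hxR) (sub_nonneg.2 ht1) ht0 (by ring)
  · intro φ hφ hφc
    rw [setIntegral_fderiv_convexCombination hR h.1 h'.1 t hφ hφc, ← h.2 φ hφ hφc,
      ← h'.2 φ hφ hφc]
    ring

/-- Wherever some competitor takes values in the interior of the Newton polytope, so does the
limit shape. -/
theorem IsLimitShape.ae_mem_interior (hR : IsCompact R) (hω : IsLimitShape Λ R b ω)
    (hω' : ω' ∈ asymptoticFlows Λ R b) :
    ∀ᵐ x ∂volume.restrict R,
      ω' x ∈ interior Λ.newtonPolytope → ω x ∈ interior Λ.newtonPolytope := by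
  set μ := volume.restrict R
  have : IsFiniteMeasure μ := ⟨by simpa [μ] using hR.measure_lt_top⟩
  obtain ⟨hmin, hmem⟩ := hω
  set C := Real.log Λ.edges.card
  set t : ℕ → ℝ := fun n => 1 / ((n : ℝ) + 1) with ht
  have ht0 : ∀ n, 0 < t n := fun n => Nat.one_div_pos_of_nat
  have ht1 : ∀ n, t n ≤ 1 := fun n => by
    rw [ht]
    exact (div_le_one (by positivity)).2 (by linarith [n.cast_nonneg (α := ℝ)])
  have htlim : Tendsto t atTop (𝓝[>] 0) :=
    tendsto_nhdsWithin_iff.2 ⟨tendsto_one_div_add_atTop_nhds_zero_nat, .of_forall ht0⟩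
  set v : ℕ → EuclideanSpace ℝ (Fin d) → EuclideanSpace ℝ (Fin d) :=
    fun n x => (1 - t n) • ω x + t n • ω' x
  have hv : ∀ n, v n ∈ asymptoticFlows Λ R b := fun n =>
    convexCombination_mem_asymptoticFlows hR hmem hω' (ht0 n).le (ht1 n)
  have hint : ∀ {w}, w ∈ asymptoticFlows Λ R b →
      Integrable (fun x => Λ.surfaceTension (w x)) μ := fun hw =>
    Λ.integrable_surfaceTension_comp hw.1.aemeasurable.restrict (hw.1.ae_restrict_mem hR)
  -- By convexity the difference quotient is at least σ(ω) - σ(ω') ≥ -C. Adding C makes g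
  -- nonnegative, as Fatou's lemma requires.
  set g : ℕ → EuclideanSpace ℝ (Fin d) → ℝ := fun n x =>
    C + (Λ.surfaceTension (ω x) - Λ.surfaceTension (v n x)) / t n with hg
  have hgint : ∀ n, Integrable (g n) μ := fun n =>
    (integrable_const C).add (((hint hmem).sub (hint (hv n))).div_const _)
  have hgnonneg : ∀ n, 0 ≤ᵐ[μ] g n := fun n => by
    filter_upwards [hmem.1.ae_restrict_mem hR, hω'.1.ae_restrict_mem hR] with x hx hx'
    have h1 := Λ.surfaceTension_convexCombination_le hx hx' (ht0 n).le (ht1 n)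
    have h2 := Λ.neg_log_card_le_surfaceTension hx
    have h3 := Λ.surfaceTension_nonpos hx'
    have h4 : -C ≤ (Λ.surfaceTension (ω x) - Λ.surfaceTension (v n x)) / t n := by
      rw [le_div_iff₀ (ht0 n)]
      have h5 := mul_le_mul_of_nonneg_left h2 (ht0 n).le
      have h6 := mul_nonpos_of_nonneg_of_nonpos (ht0 n).le h3
      linarith
    show 0 ≤ C + _
    linarith
  -- Minimality makes the integrated difference quotient nonpositive, so only the constant remains.
  have hgle : ∀ n, ∫⁻ x, ENNReal.ofReal (g n x) ∂μ ≤ ENNReal.ofReal (∫ _, C ∂μ) := fun n => by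
    rw [← ofReal_integral_eq_lintegral_ofReal (hgint n) (hgnonneg n)]
    refine ENNReal.ofReal_le_ofReal ?_
    have h1 : ∫ x, g n x ∂μ = (∫ _, C ∂μ) +
        ((∫ x, Λ.surfaceTension (ω x) ∂μ) - ∫ x, Λ.surfaceTension (v n x) ∂μ) / t n := by
      rw [← integral_sub (hint hmem) (hint (hv n)), ← integral_div]
      exact integral_add (integrable_const C) (((hint hmem).sub (hint (hv n))).div_const _)
    have h2 : ∫ x, Λ.surfaceTension (ω x) ∂μ ≤ ∫ x, Λ.surfaceTension (v n x) ∂μ :=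
      hmin (hv n)
    rw [h1]
    linarith [div_nonpos_of_nonpos_of_nonneg (sub_nonpos.2 h2) (ht0 n).le]
  have hmeas : ∀ n, AEMeasurable (fun x => ENNReal.ofReal (g n x)) μ := fun n =>
    (hgint n).aemeasurable.ennreal_ofReal
  have hliminf : AEMeasurable (fun x => liminf (fun n => ENNReal.ofReal (g n x)) atTop) μ := by
    simp only [liminf_eq_iSup_iInf_of_nat]
    exact .iSup fun n => .biInf _ (to_countable _) fun i _ => hmeas i
  have hfatou : ∫⁻ x, liminf (fun n => ENNReal.ofReal (g n x)) atTop ∂μ ≠ ⊤ := by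
    refine ((lintegral_liminf_le' hmeas).trans ?_).trans_lt
      (ENNReal.ofReal_lt_top (r := ∫ _, C ∂μ)) |>.ne
    exact (liminf_le_liminf (.of_forall hgle)).trans_eq (liminf_const _)
  filter_upwards [ae_lt_top' hliminf hfatou,
    hmem.1.ae_restrict_mem hR] with x hlt hx hx'
  by_contra hnot
  -- The infinite slope contradicts the finite liminf given by Fatou's lemma.
  have hlim : Tendsto (fun n => g n x) atTop atTop := by
    refine tendsto_atTop.2 fun K => ?_
    filter_upwards [htlim.eventually
      (Λ.eventually_surfaceTension_le_sub hx hnot hx' (K - C))] with n hn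
    have : K - C ≤ (Λ.surfaceTension (ω x) - Λ.surfaceTension (v n x)) / t n := by
      rw [le_div_iff₀ (ht0 n)]
      linarith
    show K ≤ C + _
    linarith
  exact hlt.ne (ENNReal.tendsto_ofReal_atTop.comp hlim).liminf_eq

end Flows

theorem mainTheorem6 {d : ℕ} (Λ : DimerLattice d) (R : Set (EuclideanSpace ℝ (Fin d)))
    (hR : IsCompactDomain R) (b : SignedMeasure (EuclideanSpace ℝ (Fin d)))
    (hflex : IsFlexible Λ R b)
    (ω : EuclideanSpace ℝ (Fin d) → EuclideanSpace ℝ (Fin d)) (hω : IsLimitShape Λ R b ω) :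
    (∀ᵐ x, x ∈ interior R → ω x ∈ interior Λ.newtonPolytope) ∧
      ¬ ∃ A : Set (EuclideanSpace ℝ (Fin d)), IsFacet Λ R ω A := by
  have main : ∀ᵐ x, x ∈ interior R → ω x ∈ interior Λ.newtonPolytope := by
    rw [ae_iff]
    -- The flow ω' depends on the point. Second countability of the space reduces the claim to one
    -- neighbourhood at a time.
    refine measure_null_of_locally_null _ fun x hx => ?_
    simp only [Classical.not_imp, mem_ofPred_eq] at hx
    obtain ⟨U, hU, hUR, ω', hω', hint⟩ := hflex x hx.1
    refine ⟨U ∩ _, inter_mem (mem_nhdsWithin_of_mem_nhds hU) self_mem_nhdsWithin, ?_⟩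
    have h := (ae_restrict_iff' hR.isCompact.measurableSet).1
      (hω.ae_mem_interior hR.isCompact hω')
    refine measure_mono_null (fun y hy => ?_) (ae_iff.1 (hint.and h))
    rintro ⟨h1, h2⟩
    exact hy.2 fun _ => h2 (hUR hy.1) (h1 hy.1)
  refine ⟨main, ?_⟩
  rintro ⟨A, hA, hpos, hfr⟩
  refine hpos.ne' (measure_mono_null (fun x hx => ?_) (ae_iff.1 (main.and hfr)))
  rintro ⟨h1, h2⟩
  exact (h2 hx).2 (h1 (hA hx))
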